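/- All graphs are finite and have no loops; multiple edges are allowed, and a graph is simple if it has no multiple edges. $\omega(G)$ is the number of connected components of $G$. For a set $A$ of integers, an $A$-factor of $G$ is a spanning subgraph of $G$ all of whose vertex degrees lie in $A$, and a $2$-factor is a $\{2\}$-factor. The girth of a graph is the length of its shortest cycle, where two parallel edges form a cycle of length two. A graph is $2$-connected if it has at least three vertices, is connected, and remains connected after the deletion of any one vertex. A graph $G$ is $16$-tough if $\omega(G\setminus S)\le \max\{1,\frac{1}{16}|S|\}$ for all $S\subseteq V(G)$. (1) Let $G$ be a simple graph with at least one vertex, and let $F$ be a $2$-factor of $G$ with girth at least five. If $\omega(G\setminus S)\le \frac{1}{16}|S|+1$ for all $S\subseteq V(G)$, then $G$ has a $2$-connected $\{2,3\}$-factor containing $F$. (2) Let $G$ be a graph (possibly with multiple edges) of order at least three. If $G$ is $16$-tough and has a $2$-factor with girth at least five, then $G$ has a $2$-connected $\{2,3\}$-factor. -/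

import Mathlib

/- Multigraphs are Mathlib's `Graph α β`, with vertex set `G.vertexSet : Set α` and
edge set `G.edgeSet : Set β`; parallel edges are different elements of `β`. -/

noncomputable section

namespace Graph

variable {α β : Type*}

/-- The number `ω(G)` of connected components of `G`. Loops and multiplicities of edges do not
matter for connectedness, so these are the components of the underlying simple graph. -/
def numComponents (G : Graph α β) : ℕ :=
  Nat.card G.toSimpleGraph.ConnectedComponent

/-- `G` is connected (in particular, it has a vertex). -/
def IsConnected (G : Graph α β) : Prop :=
  G.toSimpleGraph.Connected

/-- `G` is 2-connected: it has at least three vertices, is connected, and stays connected when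
any single vertex is deleted. -/
def IsTwoConnected (G : Graph α β) : Prop :=
  3 ≤ G.vertexSet.encard ∧ G.IsConnected ∧
    ∀ v ∈ G.vertexSet, (G.deleteVerts {v}).IsConnected

/-- The degree of `v` in a loopless multigraph: the number of edges incident to `v`. -/
def degree (G : Graph α β) (v : α) : ℕ :=
  (G.incidenceSet v).ncard

/-- `F` is an `A`-factor of `G`: a spanning subgraph all of whose degrees are in `A`. -/
def IsFactor (A : Set ℕ) (F G : Graph α β) : Prop :=
  F.IsSpanningSubgraph G ∧ ∀ v ∈ F.vertexSet, F.degree v ∈ A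

/-- `G` has a cycle of length `n`: there are pairwise distinct vertices `x i` and pairwise
distinct edges `e i`, indexed cyclically, such that `e i` joins `x i` and `x (i + 1)`.
A loop is a cycle of length one, a pair of parallel edges one of length two. -/
def HasCycleOfLength (G : Graph α β) (n : ℕ) : Prop :=
  0 < n ∧ ∃ (x : ZMod n → α) (e : ZMod n → β),
    Function.Injective x ∧ Function.Injective e ∧ ∀ i, G.IsLink (e i) (x i) (x (i + 1))

/-- The girth of `G`: the length of a shortest cycle (`⊤` if there is no cycle). -/
def girth (G : Graph α β) : ℕ∞ :=
  ⨅ (n : ℕ) (_ : G.HasCycleOfLength n), (n : ℕ∞)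

/-- `G` is `t`-tough: `ω(G \ S) ≤ max {1, |S| / t}` for every set `S` of vertices. -/
def IsTough (t : ℝ) (G : Graph α β) : Prop :=
  ∀ S ⊆ G.vertexSet, ((G.deleteVerts S).numComponents : ℝ) ≤ max 1 ((S.ncard : ℝ) / t)

end Graph

end

/-! Contract each component of the 2-factor `F`, a cycle, to a point, and let `K` be the set of
these points. It suffices to find a matching `M` of `G` whose image on `K` has 2|K| - 2 edges, with
at most 2|A| - 2 of them inside any nonempty set A (a union of two edge-disjoint spanning trees).
Then `F` together with `M` has degrees 2 and 3. Every cut of `K` contains at least two edges of `M`,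
while deleting a vertex destroys at most one edge of `M` and turns one cycle into a path, so the
graph stays connected (`exists_cut_edge`).

For the existence of `M` (`exists_sparse_matching`), take a maximum sparse matching H. The sets with
exactly 2|A| - 2 inner edges can be uncrossed, so the maximal ones partition `K`. An augmentation
argument (`exists_blocking_set`) yields a set S of vertices covered by H such that every edge of `G`
avoiding S stays inside a part of the partition defined by the edges of H avoiding S.

If H had fewer than 2|K| - 2 edges, the set X of its edges between different parts would be small:
|X| ≤ 2|P| - 3 for |P| parts. Deleting the set Z of their ends, which contains S, separates the
parts, so toughness bounds the number of parts that keep a vertex. A part swallowed by Z is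
expensive: each of its cycles has at least five vertices, all of them ends of edges of X, whereas
sparsity limits the edges of X inside the union of the swallowed parts. These bounds are
incompatible. -/

noncomputable section

namespace SparseMatching

open Finset Classical

variable {V K E : Type*}

/-! ### Sparse edge sets and their tight sets -/

/-- The edges of `H` with both ends in `A`. -/
def inner (p q : E → K) (H : Finset E) (A : Finset K) : Finset E :=
  H.filter fun e => p e ∈ A ∧ q e ∈ A

/-- The sparsity condition defining independence in the union of two graphic matroids. -/
def Sparse (p q : E → K) (H : Finset E) : Prop :=
  ∀ A : Finset K, A.Nonempty → #(inner p q H A) + 2 ≤ 2 * #A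

/-- A set on which the sparsity condition holds with equality. -/
def Tight (p q : E → K) (H : Finset E) (A : Finset K) : Prop :=
  A.Nonempty ∧ #(inner p q H A) + 2 = 2 * #A

section Sparse

variable {p q : E → K} {H H' : Finset E} {A B : Finset K} {e f : E} {j k : K}

lemma mem_inner : e ∈ inner p q H A ↔ e ∈ H ∧ p e ∈ A ∧ q e ∈ A := by
  simp [inner]

lemma inner_mono (h : H ⊆ H') : inner p q H A ⊆ inner p q H' A :=
  filter_subset_filter _ h

lemma Sparse.mono (h : Sparse p q H') (hs : H ⊆ H') : Sparse p q H := fun A hA =>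
  (Nat.add_le_add_right (card_le_card (inner_mono hs)) 2).trans (h A hA)

lemma Tight.mono (h : Tight p q H A) (hs : H ⊆ H') (h' : Sparse p q H') : Tight p q H' A := by
  have h1 := h' A h.1
  have h2 := card_le_card (inner_mono (p := p) (q := q) (A := A) hs)
  exact ⟨h.1, by have := h.2; omega⟩

lemma Tight.inner_eq (h : Tight p q H A) (hs : H ⊆ H') (h' : Sparse p q H') :
    inner p q H A = inner p q H' A :=
  eq_of_subset_of_card_le (inner_mono hs) (by have := h.2; have := h' A h.1; omega)

lemma card_inner_add_le (p q : E → K) (H : Finset E) (A B : Finset K) :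
    #(inner p q H A) + #(inner p q H B) ≤ #(inner p q H (A ∪ B)) + #(inner p q H (A ∩ B)) := by
  rw [← card_union_add_card_inter]
  refine Nat.add_le_add (card_le_card ?_) (card_le_card ?_)
  · intro e; simp only [mem_union, mem_inner]; tauto
  · intro e; simp only [mem_inter, mem_inner]; tauto

/-- Uncrossing: the number of inner edges is supermodular and 2|A| - 2 is modular, so the slack
cannot stay positive on either set. Nonemptiness of the intersection is what makes sparsity apply to
it. -/
lemma Tight.union_inter (hA : Tight p q H A) (hB : Tight p q H B) (h : Sparse p q H)
    (hAB : (A ∩ B).Nonempty) : Tight p q H (A ∪ B) ∧ Tight p q H (A ∩ B) := by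
  have h1 := card_inner_add_le p q H A B
  have h2 := h _ hAB
  have hU : (A ∪ B).Nonempty := hA.1.mono subset_union_left
  have h3 := h _ hU
  have h4 := card_union_add_card_inter A B
  have h5 := hA.2
  have h6 := hB.2
  exact ⟨⟨hU, by omega⟩, ⟨hAB, by omega⟩⟩

/-- Sparsity at one point leaves room for no edge; in particular sparse sets contain no loops. -/
lemma Sparse.tight_singleton (h : Sparse p q H) (k : K) : Tight p q H {k} := by
  have := h {k} (singleton_nonempty k)
  refine ⟨singleton_nonempty k, ?_⟩
  simp only [card_singleton] at *
  omega

lemma Sparse.insert (h : Sparse p q H) (he : ∀ A, Tight p q H A → p e ∈ A → q e ∉ A) :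
    Sparse p q (insert e H) := by
  intro A hA
  have h1 := h A hA
  by_cases hin : p e ∈ A ∧ q e ∈ A
  · have h2 : #(inner p q H A) + 2 ≠ 2 * #A := fun h2 => he A ⟨hA, h2⟩ hin.1 hin.2
    have h3 : inner p q (Insert.insert e H) A ⊆ Insert.insert e (inner p q H A) := by
      intro x; simp only [mem_insert, mem_inner]; tauto
    have h4 := (card_le_card h3).trans (card_insert_le _ _)
    omega
  · have h3 : inner p q (Insert.insert e H) A ⊆ inner p q H A := by
      intro x
      simp only [mem_insert, mem_inner]
      rintro ⟨rfl | hx, hx'⟩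
      · exact absurd hx' hin
      · exact ⟨hx, hx'⟩
    have := card_le_card h3
    omega

/-- A set that is tight after removing `f` was tight before with the same inner edges, hence does
not contain both ends of `f`; so no such set blocks the insertion of `e`. -/
lemma Sparse.exchange (h : Sparse p q H) (hf : f ∈ H)
    (he : ∀ A, Tight p q H A → p e ∈ A → q e ∈ A → p f ∈ A ∧ q f ∈ A) :
    Sparse p q (Insert.insert e (H.erase f)) := by
  refine (h.mono (erase_subset f H)).insert fun A hA h1 h2 => ?_
  have h3 := hA.mono (erase_subset f H) h
  have h4 := hA.inner_eq (erase_subset f H) h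
  have h5 : f ∈ inner p q H A := mem_inner.2 ⟨hf, he A h3 h1 h2⟩
  rw [← h4, mem_inner] at h5
  simp at h5

lemma card_inner_replace (p q : E → K) (H H' : Finset E) (hBA : B ⊆ A) :
    #(inner p q (H.filter (fun e => ¬ (p e ∈ B ∧ q e ∈ B)) ∪ inner p q H' B) A) +
      #(inner p q H B) = #(inner p q H A) + #(inner p q H' B) := by
  have e1 : inner p q (H.filter (fun e => ¬ (p e ∈ B ∧ q e ∈ B)) ∪ inner p q H' B) A =
      (inner p q H A).filter (fun e => ¬ (p e ∈ B ∧ q e ∈ B)) ∪ inner p q H' B := by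
    ext x
    have := @hBA (p x)
    have := @hBA (q x)
    simp only [mem_inner, mem_union, mem_filter]; tauto
  have e2 : inner p q H A =
      (inner p q H A).filter (fun e => ¬ (p e ∈ B ∧ q e ∈ B)) ∪ inner p q H B := by
    ext x
    have := @hBA (p x)
    have := @hBA (q x)
    simp only [mem_inner, mem_union, mem_filter]; tauto
  rw [e1, card_union_of_disjoint, congrArg card e2, card_union_of_disjoint]
  · omega
  · rw [disjoint_left]; intro x; simp only [mem_inner, mem_filter]; tauto
  · rw [disjoint_left]; intro x; simp only [mem_inner, mem_filter]; tauto

lemma card_inner_exchange (hf : f ∈ inner p q H A) (he : e ∉ H) (hp : p e ∈ A) (hq : q e ∈ A) :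
    #(inner p q (Insert.insert e (H.erase f)) A) = #(inner p q H A) := by
  have e1 : inner p q (Insert.insert e (H.erase f)) A =
      Insert.insert e ((inner p q H A).erase f) := by
    ext x
    simp only [mem_inner, mem_insert, mem_erase]
    constructor
    · tauto
    · rintro (rfl | h1)
      · exact ⟨.inl rfl, hp, hq⟩
      · tauto
  rw [e1, card_insert_of_notMem, card_erase_add_one hf]
  simp [mem_inner, he]

/-- Replacing the edges inside a tight set by another tight set of edges preserves sparsity. -/
lemma Sparse.replace (h : Sparse p q H) (h' : Sparse p q H') (hB : Tight p q H B)
    (hB' : Tight p q H' B) :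
    Sparse p q (H.filter (fun e => ¬ (p e ∈ B ∧ q e ∈ B)) ∪ inner p q H' B) := by
  set J := H.filter (fun e => ¬ (p e ∈ B ∧ q e ∈ B)) ∪ inner p q H' B with hJ
  have hin : ∀ A, A ⊆ B → inner p q J A = inner p q H' A := by
    intro A hAB
    ext x
    have := @hAB (p x)
    have := @hAB (q x)
    simp only [hJ, mem_inner, mem_union, mem_filter]; tauto
  intro A hA
  rcases (A ∩ B).eq_empty_or_nonempty with h0 | h0
  · have h1 : inner p q J A ⊆ inner p q H A := by
      intro x
      have : p x ∈ A → p x ∉ B := fun h1 h2 => by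
        have : p x ∈ A ∩ B := mem_inter.2 ⟨h1, h2⟩
        simp [h0] at this
      simp only [hJ, mem_inner, mem_union, mem_filter]; tauto
    have := card_le_card h1
    have := h A hA
    omega
  -- Uncross `A` with `B`: `J` is as dense as `H` on `A ∪ B`, because both fillings of `B` have the
  -- same size, and it agrees with `H'` on `A ∩ B`.
  · have h1 := card_inner_add_le p q J A B
    have h2 := h _ (hA.mono (subset_union_left (s₂ := B)))
    have h3 := h' _ h0
    rw [hin _ inter_subset_right, hin _ Subset.rfl] at h1
    have h4 := card_union_add_card_inter A B
    have h5 := card_inner_replace p q H H' (subset_union_right (s₁ := A) (s₂ := B))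
    rw [← hJ] at h5
    have := hB.2
    have := hB'.2
    omega

variable [Fintype K]

/-- The union of the tight sets that contain `k`. -/
def part (p q : E → K) (H : Finset E) (k : K) : Finset K :=
  univ.filter fun j => ∃ A, Tight p q H A ∧ k ∈ A ∧ j ∈ A

lemma mem_part : j ∈ part p q H k ↔ ∃ A, Tight p q H A ∧ k ∈ A ∧ j ∈ A := by
  simp [part]

/-- A largest tight set containing `k` absorbs all others by uncrossing, so it is the whole union.
-/
lemma Sparse.tight_part (h : Sparse p q H) (k : K) : Tight p q H (part p q H k) := by
  obtain ⟨M, hM, hmax⟩ := (univ.filter fun A : Finset K => Tight p q H A ∧ k ∈ A).exists_max_image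
    (fun A => #A) ⟨{k}, by simp [h.tight_singleton k]⟩
  simp only [mem_filter, mem_univ, true_and] at hM hmax
  convert hM.1 using 1
  ext j
  rw [mem_part]
  constructor
  · rintro ⟨A, hA, hk, hj⟩
    have h1 := (hM.1.union_inter hA h ⟨k, mem_inter.2 ⟨hM.2, hk⟩⟩).1
    have h2 := hmax _ ⟨h1, mem_union_left _ hM.2⟩
    rw [eq_of_subset_of_card_le (subset_union_left (s₁ := M) (s₂ := A)) h2]
    exact mem_union_right _ hj
  · exact fun hj => ⟨M, hM.1, hM.2, hj⟩

lemma Tight.subset_part (h : Tight p q H A) (hk : k ∈ A) : A ⊆ part p q H k := fun _ hj =>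
  mem_part.2 ⟨A, h, hk, hj⟩

lemma Sparse.mem_part_self (h : Sparse p q H) (k : K) : k ∈ part p q H k :=
  (h.tight_singleton k).subset_part (mem_singleton_self k) (mem_singleton_self k)

lemma mem_part_comm : j ∈ part p q H k ↔ k ∈ part p q H j := by
  simp only [mem_part]
  exact exists_congr fun A => by tauto

lemma Sparse.part_subset (h : Sparse p q H) (hj : j ∈ part p q H k) :
    part p q H j ⊆ part p q H k := by
  have h1 := (h.tight_part k).union_inter (h.tight_part j) h
    ⟨j, mem_inter.2 ⟨hj, h.mem_part_self j⟩⟩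
  exact subset_union_right.trans (h1.1.subset_part (mem_union_left _ (h.mem_part_self k)))

lemma Sparse.part_eq (h : Sparse p q H) (hj : j ∈ part p q H k) :
    part p q H j = part p q H k :=
  (h.part_subset hj).antisymm (h.part_subset (mem_part_comm.1 hj))

lemma Sparse.part_mono (h : Sparse p q H') (hs : H ⊆ H') (k : K) :
    part p q H k ⊆ part p q H' k :=
  (((h.mono hs).tight_part k).mono hs h).subset_part ((h.mono hs).mem_part_self k)

end Sparse

/-! ### Matchings and edges avoiding a vertex set -/

section Matching

variable {a b : E → V} {H H' J : Finset E} {S T : Finset V} {e f : E} {v : V}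

/-- The vertex `v` is an end of the edge `e`. -/
def Touches (a b : E → V) (e : E) (v : V) : Prop := a e = v ∨ b e = v

/-- The edge `e` has no end in `S`. -/
def Avoids (a b : E → V) (S : Finset V) (e : E) : Prop := a e ∉ S ∧ b e ∉ S

/-- Some edge of `H` has `v` as an end. -/
def Covers (a b : E → V) (H : Finset E) (v : V) : Prop := ∃ e ∈ H, Touches a b e v

/-- No two edges of `H` have a common end. -/
def IsMatching (a b : E → V) (H : Finset E) : Prop :=
  ∀ e ∈ H, ∀ f ∈ H, ∀ v, Touches a b e v → Touches a b f v → e = f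

/-- The edges of `H` without an end in `S`. -/
def away (a b : E → V) (H : Finset E) (S : Finset V) : Finset E := H.filter (Avoids a b S)

lemma mem_away : e ∈ away a b H S ↔ e ∈ H ∧ Avoids a b S e := by simp [away]

lemma away_subset : away a b H S ⊆ H := filter_subset _ _

lemma Avoids.anti (h : Avoids a b T e) (hs : S ⊆ T) : Avoids a b S e :=
  ⟨fun h1 => h.1 (hs h1), fun h1 => h.2 (hs h1)⟩

lemma away_anti (hs : S ⊆ T) : away a b H T ⊆ away a b H S := fun e he => by
  rw [mem_away] at *
  exact ⟨he.1, he.2.anti hs⟩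

lemma away_empty : away a b H ∅ = H := by
  ext e; simp [mem_away, Avoids]

lemma IsMatching.insert (h : IsMatching a b H) (ha : ¬ Covers a b H (a e))
    (hb : ¬ Covers a b H (b e)) : IsMatching a b (Insert.insert e H) := by
  have key : ∀ x ∈ H, ∀ v, Touches a b x v → ¬ Touches a b e v := by
    rintro x hx v hv (rfl | rfl)
    · exact ha ⟨x, hx, hv⟩
    · exact hb ⟨x, hx, hv⟩
  intro x hx y hy v hxv hyv
  rw [mem_insert] at hx hy
  rcases hx with rfl | hx <;> rcases hy with rfl | hy
  · rfl
  · exact absurd hxv (key y hy v hyv)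
  · exact absurd hyv (key x hx v hxv)
  · exact h x hx y hy v hxv hyv

lemma IsMatching.mono (h : IsMatching a b H) (hs : J ⊆ H) : IsMatching a b J :=
  fun e he f hf => h e (hs he) f (hs hf)

end Matching

/-! ### Exchanges and the blocking set -/

section Exchange

variable [Fintype K] {π : V → K} {a b : E → V} {H H' H₁ H₂ : Finset E} {S T : Finset V}
  {e f : E} {v : V} {k : K}

/-- The parts of the tight partition of the edges of `H` that avoid `S`. -/
abbrev partAway (π : V → K) (a b : E → V) (H : Finset E) (S : Finset V) (k : K) : Finset K :=
  part (π ∘ a) (π ∘ b) (away a b H S) k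

/-- A union of parts of the tight partition of the edges of `H` that avoid `S`. -/
def Saturated (π : V → K) (a b : E → V) (H : Finset E) (S : Finset V) (A : Finset K) : Prop :=
  ∀ k ∈ A, partAway π a b H S k ⊆ A

/-- `H'` arises from `H` by exchanging edges that avoid `S` within the parts of the tight
partition of the edges of `H` that avoid `S`. -/
structure Exch (π : V → K) (a b : E → V) (H : Finset E) (S : Finset V) (H' : Finset E) :
    Prop where
  isMatching : IsMatching a b H'
  sparse : Sparse (π ∘ a) (π ∘ b) H'
  mem_iff_or : ∀ e, (e ∈ H' ↔ e ∈ H) ∨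
    (Avoids a b S e ∧ π (b e) ∈ partAway π a b H S (π (a e)))
  -- This keeps every part tight and, applied to all of `K`, keeps the number of edges.
  card_eq : ∀ A, Saturated π a b H S A →
    #(inner (π ∘ a) (π ∘ b) H' A) = #(inner (π ∘ a) (π ∘ b) H A)

lemma Exch.refl (hm : IsMatching a b H) (hs : Sparse (π ∘ a) (π ∘ b) H) (S : Finset V) :
    Exch π a b H S H :=
  ⟨hm, hs, fun _ => .inl .rfl, fun _ _ => rfl⟩

lemma Saturated.anti (hs : Sparse (π ∘ a) (π ∘ b) H) (hST : S ⊆ T) {A : Finset K}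
    (h : Saturated π a b H S A) : Saturated π a b H T A := fun k hk =>
  ((hs.mono away_subset).part_mono (away_anti hST) k).trans (h k hk)

lemma Exch.anti (hs : Sparse (π ∘ a) (π ∘ b) H) (hST : S ⊆ T) (h : Exch π a b H T H') :
    Exch π a b H S H' where
  isMatching := h.isMatching
  sparse := h.sparse
  mem_iff_or e := (h.mem_iff_or e).imp_right fun h1 =>
    ⟨h1.1.anti hST, (hs.mono away_subset).part_mono (away_anti hST) _ h1.2⟩
  card_eq A hA := h.card_eq A (hA.anti hs hST)

lemma saturated_partAway (hs : Sparse (π ∘ a) (π ∘ b) H) (S : Finset V) (k : K) :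
    Saturated π a b H S (partAway π a b H S k) := fun _ hj =>
  (hs.mono away_subset).part_subset hj

/-- Only edges avoiding `S` are exchanged, so the edges meeting `S` contribute equally to both sides
of `card_eq`. -/
lemma Exch.card_away_eq (h : Exch π a b H S H') {A : Finset K} (hA : Saturated π a b H S A) :
    #(inner (π ∘ a) (π ∘ b) (away a b H' S) A) = #(inner (π ∘ a) (π ∘ b) (away a b H S) A) := by
  have split : ∀ J : Finset E, #(inner (π ∘ a) (π ∘ b) J A) =
      #(inner (π ∘ a) (π ∘ b) (away a b J S) A) +
        #((inner (π ∘ a) (π ∘ b) J A).filter fun e => ¬ Avoids a b S e) := by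
    intro J
    rw [← card_filter_add_card_filter_not (s := inner (π ∘ a) (π ∘ b) J A) (Avoids a b S)]
    congr 2
    ext x
    simp only [mem_filter, mem_inner, mem_away]; tauto
  have h1 := split H
  have h2 := split H'
  have h3 : (inner (π ∘ a) (π ∘ b) H' A).filter (fun e => ¬ Avoids a b S e) =
      (inner (π ∘ a) (π ∘ b) H A).filter fun e => ¬ Avoids a b S e := by
    ext x
    have := h.mem_iff_or x
    simp only [mem_filter, mem_inner]; tauto
  have h4 := h.card_eq A hA
  rw [h3] at h2
  omega

lemma Exch.tight_away (hs : Sparse (π ∘ a) (π ∘ b) H) (h : Exch π a b H S H') (k : K) :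
    Tight (π ∘ a) (π ∘ b) (away a b H' S) (partAway π a b H S k) := by
  have h1 := (hs.mono (away_subset (a := a) (b := b) (S := S))).tight_part k
  exact ⟨h1.1, by rw [h.card_away_eq (saturated_partAway hs S k)]; exact h1.2⟩

lemma Exch.tight (hs : Sparse (π ∘ a) (π ∘ b) H) (h : Exch π a b H S H') (k : K) :
    Tight (π ∘ a) (π ∘ b) H' (partAway π a b H S k) :=
  (h.tight_away hs k).mono away_subset h.sparse

/-- Exchanging edges does not coarsen the tight partition. -/
lemma Exch.partAway_subset (hs : Sparse (π ∘ a) (π ∘ b) H) (h : Exch π a b H S H') (k : K) :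
    partAway π a b H' S k ⊆ partAway π a b H S k := by
  have hs' := h.sparse.mono (away_subset (a := a) (b := b) (S := S))
  have hsat : Saturated π a b H S (partAway π a b H' S k) := by
    intro j hj
    refine Subset.trans ?_ (hs'.part_subset hj)
    exact (h.tight_away hs j).subset_part ((hs.mono away_subset).mem_part_self j)
  have ht := hs'.tight_part k
  refine Tight.subset_part ⟨ht.1, ?_⟩ (hs'.mem_part_self k)
  rw [← h.card_away_eq hsat]
  exact ht.2

/-- Use `H₂` inside one part and `H₁` elsewhere. The edges leaving the part are those of `H` in both
exchanges, so the two pieces fit together as a matching, and sparsity survives because the part is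
tight for both. -/
lemma Exch.combine (hs : Sparse (π ∘ a) (π ∘ b) H) (h₁ : Exch π a b H S H₁)
    (h₂ : Exch π a b H S H₂) (k : K) :
    ∃ H', Exch π a b H S H' ∧
      (∀ v, π v ∈ partAway π a b H S k → Covers a b H' v → Covers a b H₂ v) ∧
      (∀ v, π v ∉ partAway π a b H S k → Covers a b H' v → Covers a b H₁ v) := by
  set B := partAway π a b H S k with hB
  set J := H₁.filter (fun e => ¬ ((π ∘ a) e ∈ B ∧ (π ∘ b) e ∈ B)) ∪
    inner (π ∘ a) (π ∘ b) H₂ B with hJ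
  have hs' := hs.mono (away_subset (a := a) (b := b) (S := S))
  have memJ : ∀ x, x ∈ J ↔ (x ∈ H₁ ∧ ¬ (π (a x) ∈ B ∧ π (b x) ∈ B)) ∨
      (x ∈ H₂ ∧ π (a x) ∈ B ∧ π (b x) ∈ B) := by
    intro x; simp [hJ, mem_inner]
  have hcross : ∀ x, ¬ (π (a x) ∈ B ∧ π (b x) ∈ B) → (π (a x) ∈ B ∨ π (b x) ∈ B) →
      π (b x) ∉ partAway π a b H S (π (a x)) := by
    intro x hx hx' hmem
    rcases hx' with h1 | h1
    · exact hx ⟨h1, hs'.part_subset h1 hmem⟩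
    · exact hx ⟨hs'.part_subset h1 (mem_part_comm.1 hmem), h1⟩
  -- an edge of `J` with an end in `B` belongs to `H₂`
  have touchB : ∀ x ∈ J, (π (a x) ∈ B ∨ π (b x) ∈ B) → x ∈ H₂ := by
    intro x hx hx'
    rcases (memJ x).1 hx with h1 | h1
    · have hc := hcross x h1.2 hx'
      rcases h₁.mem_iff_or x with h3 | h3
      · rcases h₂.mem_iff_or x with h4 | h4
        · exact h4.2 (h3.1 h1.1)
        · exact absurd h4.2 hc
      · exact absurd h3.2 hc
    · exact h1.1
  have notB : ∀ x ∈ J, (π (a x) ∉ B ∨ π (b x) ∉ B) → x ∈ H₁ := by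
    intro x hx hx'
    rcases (memJ x).1 hx with h1 | h1
    · exact h1.1
    · tauto
  have cov₂ : ∀ x ∈ J, ∀ v, π v ∈ B → Touches a b x v → x ∈ H₂ := by
    rintro x hx v hv (rfl | rfl)
    · exact touchB x hx (.inl hv)
    · exact touchB x hx (.inr hv)
  have cov₁ : ∀ x ∈ J, ∀ v, π v ∉ B → Touches a b x v → x ∈ H₁ := by
    rintro x hx v hv (rfl | rfl)
    · exact notB x hx (.inl hv)
    · exact notB x hx (.inr hv)
  refine ⟨J, ⟨?_, h₁.sparse.replace h₂.sparse (h₁.tight hs k) (h₂.tight hs k), ?_, ?_⟩, ?_, ?_⟩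
  · intro x hx y hy v hxv hyv
    by_cases hv : π v ∈ B
    · exact h₂.isMatching x (cov₂ x hx v hv hxv) y (cov₂ y hy v hv hyv) v hxv hyv
    · exact h₁.isMatching x (cov₁ x hx v hv hxv) y (cov₁ y hy v hv hyv) v hxv hyv
  · intro x
    have := h₁.mem_iff_or x
    have := h₂.mem_iff_or x
    have := memJ x
    tauto
  · intro A hA
    rcases (A ∩ B).eq_empty_or_nonempty with h0 | ⟨j, hj⟩
    · rw [← h₁.card_eq A hA]
      congr 1
      ext x
      have : π (a x) ∈ A → π (a x) ∉ B := fun h1 h2 => by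
        have : π (a x) ∈ A ∩ B := mem_inter.2 ⟨h1, h2⟩
        simp [h0] at this
      simp only [mem_inner, memJ, Function.comp]; tauto
    · rw [mem_inter] at hj
      have hBA : B ⊆ A := by
        rw [hB, partAway, ← hs'.part_eq hj.2]; exact hA j hj.1
      rw [← h₁.card_eq A hA]
      have h5 := card_inner_replace (π ∘ a) (π ∘ b) H₁ H₂ hBA
      rw [← hJ, h₁.card_eq B (saturated_partAway hs S k),
        h₂.card_eq B (saturated_partAway hs S k)] at h5
      omega
  · rintro v hv ⟨x, hx, hxv⟩
    exact ⟨x, cov₂ x hx v hv hxv, hxv⟩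
  · rintro v hv ⟨x, hx, hxv⟩
    exact ⟨x, cov₁ x hx v hv hxv, hxv⟩

variable [Fintype V]

/-- `S` together with the vertices covered by all exchanges relative to `S`. -/
def grow (π : V → K) (a b : E → V) (H : Finset E) (S : Finset V) : Finset V :=
  univ.filter fun v => v ∈ S ∨ ∀ H', Exch π a b H S H' → Covers a b H' v

lemma mem_grow : v ∈ grow π a b H S ↔ v ∈ S ∨ ∀ H', Exch π a b H S H' → Covers a b H' v := by
  simp [grow]

lemma subset_grow : S ⊆ grow π a b H S := fun _ hv => mem_grow.2 (.inl hv)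

/-- Every edge without an end in `grow S` lies within a part relative to `S`. -/
def Blocked (π : V → K) (a b : E → V) (H : Finset E) (S : Finset V) : Prop :=
  ∀ e, Avoids a b (grow π a b H S) e → π (b e) ∈ partAway π a b H S (π (a e))

/-- Each end of `e` is missed by some exchange. As the ends lie in different parts, `Exch.combine`
merges the two exchanges into one that misses both ends. -/
lemma exists_exch_not_covers (hs : Sparse (π ∘ a) (π ∘ b) H)
    (he : Avoids a b (grow π a b H S) e)
    (hne : π (b e) ∉ partAway π a b H S (π (a e))) :
    ∃ H', Exch π a b H S H' ∧ ¬ Covers a b H' (a e) ∧ ¬ Covers a b H' (b e) := by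
  have h1 := he.1
  have h2 := he.2
  simp only [mem_grow, not_or, not_forall] at h1 h2
  obtain ⟨-, H₂, hH₂, ha⟩ := h1
  obtain ⟨-, H₁, hH₁, hb⟩ := h2
  obtain ⟨H', hH', hc₂, hc₁⟩ := hH₁.combine hs hH₂ (π (a e))
  exact ⟨H', hH', fun h => ha (hc₂ _ ((hs.mono away_subset).mem_part_self _) h),
    fun h => hb (hc₁ _ hne h)⟩

/-- An edge violating this could be added to an exchange that misses both its ends; exchanges have
the size of `H`, so this would contradict maximality. -/
lemma blocked_empty (hs : Sparse (π ∘ a) (π ∘ b) H)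
    (hmax : ∀ J, IsMatching a b J → Sparse (π ∘ a) (π ∘ b) J → #J ≤ #H) :
    Blocked π a b H ∅ := by
  intro e he
  by_contra hne
  obtain ⟨H', hH', ha, hb⟩ := exists_exch_not_covers hs he hne
  have heH' : e ∉ H' := fun h => ha ⟨e, h, .inl rfl⟩
  have h1 : Sparse (π ∘ a) (π ∘ b) (insert e H') := by
    refine hH'.sparse.insert fun A hA h1 h2 => hne ?_
    apply hH'.partAway_subset hs
    rw [partAway, away_empty]
    exact hA.subset_part h1 h2
  have h2 := hmax _ (hH'.isMatching.insert ha hb) h1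
  rw [card_insert_of_notMem heH'] at h2
  have h3 := hH'.card_eq univ fun _ _ => subset_univ _
  have h4 : ∀ J : Finset E, inner (π ∘ a) (π ∘ b) J univ = J := fun J => by ext; simp [mem_inner]
  rw [h4, h4] at h3
  omega

/-- A violating edge `e` still lies within a part relative to `S`. Trading it for a suitable edge
`f` gives an exchange relative to `S` that uncovers a vertex of `grow S` outside `S`, which is
impossible. -/
lemma Blocked.grow (hs : Sparse (π ∘ a) (π ∘ b) H) (h : Blocked π a b H S) :
    Blocked π a b H (grow π a b H S) := by
  set T := SparseMatching.grow π a b H S with hT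
  intro e he
  by_contra hne
  obtain ⟨H', hH', ha, hb⟩ := exists_exch_not_covers hs he hne
  have heH' : e ∉ H' := fun h => ha ⟨e, h, .inl rfl⟩
  have heT : Avoids a b T e := he.anti subset_grow
  have heS : Avoids a b S e := heT.anti subset_grow
  have hA := h e heT
  set A := partAway π a b H S (π (a e)) with hAdef
  have hs' := hs.mono (away_subset (a := a) (b := b) (S := S))
  have haA : π (a e) ∈ A := hs'.mem_part_self _
  have hH'S : Exch π a b H S H' := hH'.anti hs subset_grow
  -- a smallest tight set containing both ends of `e`
  obtain ⟨C, hC, hCmin⟩ := (univ.filter fun C : Finset K =>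
      Tight (π ∘ a) (π ∘ b) H' C ∧ π (a e) ∈ C ∧ π (b e) ∈ C).exists_min_image
    (fun C => #C) ⟨A, by simpa using ⟨hH'S.tight hs _, haA, hA⟩⟩
  simp only [mem_filter, mem_univ, true_and] at hC hCmin
  have hCsub : ∀ D, Tight (π ∘ a) (π ∘ b) H' D → π (a e) ∈ D → π (b e) ∈ D → C ⊆ D := by
    intro D hD h1 h2
    have h3 := (hC.1.union_inter hD hH'.sparse ⟨π (a e), mem_inter.2 ⟨hC.2.1, h1⟩⟩).2
    have h4 := hCmin _ ⟨h3, mem_inter.2 ⟨hC.2.1, h1⟩, mem_inter.2 ⟨hC.2.2, h2⟩⟩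
    rw [← eq_of_subset_of_card_le inter_subset_left h4]
    exact inter_subset_right
  have hCA : C ⊆ A := hCsub A (hH'S.tight hs _) haA hA
  -- Otherwise `C` would be tight for the edges avoiding `T`, placing both ends of `e` in one part
  -- relative to `T`.
  obtain ⟨f, hf, hfT⟩ : ∃ f ∈ inner (π ∘ a) (π ∘ b) H' C, ¬ Avoids a b T f := by
    by_contra! hall
    refine hne (hH'.partAway_subset hs _ ?_)
    refine Tight.subset_part ⟨hC.1.1, ?_⟩ hC.2.1 hC.2.2
    rw [← hC.1.2]
    congr 2
    ext x
    have := hall x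
    simp only [mem_inner, mem_away] at *
    tauto
  rw [mem_inner] at hf
  -- `A` is already tight for the edges avoiding `S`, so every edge of `H'` inside `A` avoids `S`.
  have hfA : f ∈ inner (π ∘ a) (π ∘ b) (away a b H' S) A := by
    rw [(hH'S.tight_away hs (π (a e))).inner_eq away_subset hH'.sparse, mem_inner]
    exact ⟨hf.1, hCA hf.2.1, hCA hf.2.2⟩
  rw [mem_inner, mem_away] at hfA
  have hfS : Avoids a b S f := hfA.1.2
  obtain ⟨s, hsT, hfs⟩ : ∃ s ∈ T, Touches a b f s := by
    simp only [Avoids, not_and_or, not_not] at hfT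
    rcases hfT with h1 | h1
    · exact ⟨_, h1, .inl rfl⟩
    · exact ⟨_, h1, .inr rfl⟩
  have hsS : s ∉ S := by
    rcases hfs with rfl | rfl
    · exact hfS.1
    · exact hfS.2
  set J := insert e (H'.erase f) with hJ
  have hef : e ≠ f := fun h => heH' (h ▸ hf.1)
  have memJ : ∀ x, x ∈ J ↔ x = e ∨ (x ≠ f ∧ x ∈ H') := by intro x; simp [hJ]
  have hncov : ∀ v, ¬ Covers a b H' v → ¬ Covers a b (H'.erase f) v :=
    fun v hv ⟨x, hx, hxv⟩ => hv ⟨x, mem_of_mem_erase hx, hxv⟩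
  have hJexch : Exch π a b H S J := by
    refine ⟨(hH'.isMatching.mono (erase_subset _ _)).insert (hncov _ ha) (hncov _ hb),
      hH'.sparse.exchange hf.1 fun D hD h1 h2 =>
        ⟨hCsub D hD h1 h2 hf.2.1, hCsub D hD h1 h2 hf.2.2⟩, ?_, ?_⟩
    · intro x
      by_cases hxe : x = e
      · subst hxe; exact .inr ⟨heS, hA⟩
      by_cases hxf : x = f
      · subst hxf
        refine .inr ⟨hfS, ?_⟩
        exact hs'.part_subset (mem_part_comm.1 hfA.2.1) hfA.2.2
      rw [memJ, or_iff_right hxe, and_iff_right hxf]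
      exact hH'S.mem_iff_or x
    · intro D hD
      rw [← hH'S.card_eq D hD]
      by_cases hAD : A ⊆ D
      · exact card_inner_exchange (mem_inner.2 ⟨hf.1, hAD hfA.2.1, hAD hfA.2.2⟩) heH'
          (hAD haA) (hAD hA)
      · have hdis : ∀ j ∈ A, j ∉ D := fun j hj hjD => hAD <| by
          rw [hAdef, partAway, ← hs'.part_eq hj]; exact hD j hjD
        congr 1
        ext x
        simp only [mem_inner, memJ, Function.comp]
        constructor
        · rintro ⟨rfl | h1, h2⟩
          · exact absurd h2.1 (hdis _ haA)
          · exact ⟨h1.2, h2⟩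
        · rintro ⟨h1, h2⟩
          refine ⟨.inr ⟨?_, h1⟩, h2⟩
          rintro rfl
          exact hdis _ hfA.2.1 h2.1
  -- By definition of `T` the exchange `J` covers `s`; but `f` was the only edge of `H'` at `s`, and
  -- `e` avoids `T`.
  obtain ⟨x, hx, hxs⟩ := ((mem_grow.1 hsT).resolve_left hsS) J hJexch
  rcases (memJ x).1 hx with rfl | ⟨h1, h2⟩
  · rcases hxs with rfl | rfl
    · exact heT.1 hsT
    · exact heT.2 hsT
  · exact h1 (hH'.isMatching x h2 f hf.1 s hxs hfs)

/-- A largest blocked set covered by `H` is a fixed point of `grow`, since `H` is an exchange of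
itself and so covers whatever is added. -/
lemma exists_blocking_set (hm : IsMatching a b H) (hs : Sparse (π ∘ a) (π ∘ b) H)
    (hmax : ∀ J, IsMatching a b J → Sparse (π ∘ a) (π ∘ b) J → #J ≤ #H) :
    ∃ S : Finset V, (∀ v ∈ S, Covers a b H v) ∧
      ∀ e, Avoids a b S e → π (b e) ∈ partAway π a b H S (π (a e)) := by
  obtain ⟨S, hS, hSmax⟩ := (univ.filter fun S : Finset V =>
      (∀ v ∈ S, Covers a b H v) ∧ Blocked π a b H S).exists_max_image (fun S => #S)
    ⟨∅, by simpa using blocked_empty hs hmax⟩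
  simp only [mem_filter, mem_univ, true_and] at hS hSmax
  have h1 := hSmax (grow π a b H S) ⟨fun v hv => ?_, hS.2.grow hs⟩
  · have h2 := eq_of_subset_of_card_le subset_grow h1
    refine ⟨S, hS.1, fun e he => hS.2 e ?_⟩
    rwa [← h2]
  · rcases mem_grow.1 hv with h1 | h1
    · exact hS.1 v h1
    · exact h1 H (Exch.refl hm hs S)

end Exchange

/-! ### Counting edges between parts, and existence of the matching -/

section Count

variable [Fintype K] {p q : E → K} {H J : Finset E}

/-- Counting the edges inside a union of parts of a tight partition. -/
lemma card_inner_biUnion (hs : Sparse p q H) (hJ : J ⊆ H) {Q : Finset (Finset K)}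
    (hQ : Q ⊆ univ.image (part p q J)) :
    #(inner p q H (Q.biUnion id)) + 2 * #Q =
      #((inner p q H (Q.biUnion id)).filter fun e => q e ∉ part p q J (p e)) +
        2 * #(Q.biUnion id) := by
  have hsJ := hs.mono hJ
  have hpart : ∀ A ∈ Q, ∀ k ∈ A, part p q J k = A := by
    intro A hA k hk
    obtain ⟨j, -, rfl⟩ := mem_image.1 (hQ hA)
    exact hsJ.part_eq hk
  have htight : ∀ A ∈ Q, Tight p q H A := by
    intro A hA
    obtain ⟨j, -, rfl⟩ := mem_image.1 (hQ hA)
    exact (hsJ.tight_part j).mono hJ hs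
  have hU : #(Q.biUnion id) = ∑ A ∈ Q, #A := by
    refine card_biUnion fun A hA B hB hAB => ?_
    change Disjoint A B
    rw [disjoint_left]
    intro k hkA hkB
    exact hAB ((hpart A hA k hkA).symm.trans (hpart B hB k hkB))
  rw [← card_filter_add_card_filter_not (s := inner p q H (Q.biUnion id))
    (fun e => q e ∉ part p q J (p e))]
  have hN : #((inner p q H (Q.biUnion id)).filter fun e => ¬ q e ∉ part p q J (p e)) =
      ∑ A ∈ Q, #(inner p q H A) := by
    rw [card_eq_sum_card_fiberwise (f := fun e => part p q J (p e)) (t := Q)]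
    · refine sum_congr rfl fun A hA => congrArg card ?_
      ext e
      simp only [mem_filter, mem_inner, mem_biUnion, id, not_not]
      constructor
      · rintro ⟨⟨⟨h1, -⟩, h2⟩, rfl⟩
        exact ⟨h1, hsJ.mem_part_self _, h2⟩
      · rintro ⟨h1, h2, h3⟩
        have := hpart A hA _ h2
        exact ⟨⟨⟨h1, ⟨A, hA, h2⟩, ⟨A, hA, h3⟩⟩, this ▸ h3⟩, this⟩
    · intro e he
      simp only [coe_filter, Set.mem_ofPred_eq, mem_inner, mem_biUnion, id] at he
      obtain ⟨A, hA, h⟩ := he.1.2.1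
      simpa [hpart A hA _ h] using hA
  have hsum : ∑ A ∈ Q, #(inner p q H A) + 2 * #Q = 2 * ∑ A ∈ Q, #A := by
    rw [mul_sum, ← sum_congr rfl fun A hA => (htight A hA).2, sum_add_distrib, sum_const,
      smul_eq_mul, mul_comm 2]
  omega

end Count

/-- In `htough`, the labelling `c` is constant on components after deleting `Z`, so its values off
`Z` are at most as many as the components. It is applied with `c` sending a point to its part. -/
theorem exists_sparse_matching [Fintype V] [Fintype K] [Fintype E] [Nonempty K] (π : V → K)
    (a b : E → V) (hfib : ∀ k, 5 ≤ #(univ.filter fun v => π v = k))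
    (htough : ∀ (Z : Finset V) (c : K → Finset K),
      (∀ e, Avoids a b Z e → c (π (a e)) = c (π (b e))) →
        16 * #(Zᶜ.image fun v => c (π v)) ≤ #Z + 16) :
    ∃ H : Finset E, IsMatching a b H ∧ Sparse (π ∘ a) (π ∘ b) H ∧
      #H + 2 = 2 * Fintype.card K := by
  obtain ⟨H, hH, hmax⟩ := (univ.filter fun H : Finset E =>
      IsMatching a b H ∧ Sparse (π ∘ a) (π ∘ b) H).exists_max_image (fun H => #H) ⟨∅, by
        simp only [mem_filter, mem_univ, true_and]
        refine ⟨by simp [IsMatching], fun A hA => ?_⟩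
        have := hA.card_pos
        simp only [inner, filter_empty, card_empty]
        omega⟩
  simp only [mem_filter, mem_univ, true_and] at hH hmax
  obtain ⟨hm, hs⟩ := hH
  refine ⟨H, hm, hs, ?_⟩
  by_contra hne
  obtain ⟨S, hcov, hS⟩ := exists_blocking_set hm hs fun J h1 h2 => hmax J ⟨h1, h2⟩
  have inner_univ : inner (π ∘ a) (π ∘ b) H univ = H := by ext; simp [mem_inner]
  have hlt : #H + 2 < 2 * Fintype.card K := by
    have := hs univ univ_nonempty
    rw [inner_univ, card_univ] at this
    omega
  set J := away a b H S with hJ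
  have hJH : J ⊆ H := away_subset
  have hsJ := hs.mono hJH
  set c := part (π ∘ a) (π ∘ b) J with hc
  set X := H.filter fun e => π (b e) ∉ c (π (a e)) with hX
  set P := (univ : Finset K).image c with hP
  have hPU : P.biUnion id = univ := by
    ext k
    simp only [mem_biUnion, id, mem_univ, iff_true]
    exact ⟨c k, mem_image_of_mem _ (mem_univ _), hsJ.mem_part_self k⟩
  have hPc := card_inner_biUnion hs hJH (Subset.refl P)
  rw [hPU, inner_univ, card_univ] at hPc
  change #H + 2 * #P = #X + _ at hPc
  -- the vertices covered by edges between different parts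
  set Z := X.image a ∪ X.image b with hZ
  have hZcard : #Z ≤ 2 * #X := by
    rw [hZ]
    have h1 := card_union_le (X.image a) (X.image b)
    have h2 := card_image_le (s := X) (f := a)
    have h3 := card_image_le (s := X) (f := b)
    omega
  have hSZ : S ⊆ Z := by
    intro v hv
    obtain ⟨e, he, hev⟩ := hcov v hv
    -- An edge of `H` inside a part belongs to `J`, as the part is tight for `J`, and so avoids `S`.
    -- Hence edges with an end in `S` run between parts.
    have heX : e ∈ X := by
      rw [hX, mem_filter]
      refine ⟨he, fun hin => ?_⟩
      have h1 : e ∈ inner (π ∘ a) (π ∘ b) J (c (π (a e))) := by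
        rw [(hsJ.tight_part _).inner_eq hJH hs, mem_inner]
        exact ⟨he, hsJ.mem_part_self _, hin⟩
      have h2 := (mem_away.1 (mem_inner.1 h1).1).2
      rcases hev with rfl | rfl
      · exact h2.1 hv
      · exact h2.2 hv
    rcases hev with rfl | rfl
    · exact mem_union_left _ (mem_image_of_mem _ heX)
    · exact mem_union_right _ (mem_image_of_mem _ heX)
  have ht := htough Z c fun e he => (hsJ.part_eq (hS e (he.anti hSZ))).symm
  -- the parts all of whose vertices are in `Z`
  set Q := P.filter fun A => ∀ v, π v ∈ A → v ∈ Z with hQ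
  have hQP : Q ⊆ P := filter_subset _ _
  have hPQ : #P ≤ #(Zᶜ.image fun v => c (π v)) + #Q := by
    rw [← card_sdiff_add_card_eq_card hQP]
    refine Nat.add_le_add_right (card_le_card fun A hA => ?_) _
    rw [mem_sdiff, hQ, mem_filter, not_and] at hA
    have h1 := hA.2 hA.1
    push Not at h1
    obtain ⟨v, hvA, hvZ⟩ := h1
    obtain ⟨k, -, rfl⟩ := mem_image.1 hA.1
    exact mem_image.2 ⟨v, by simpa using hvZ, hsJ.part_eq hvA⟩
  set U := Q.biUnion id with hU
  have hQU : #Q ≤ #U := by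
    rw [hU, card_biUnion]
    · rw [card_eq_sum_ones]
      refine sum_le_sum fun A hA => ?_
      obtain ⟨k, -, rfl⟩ := mem_image.1 (hQP hA)
      exact card_pos.2 ⟨k, hsJ.mem_part_self k⟩
    · intro A hA B hB hAB
      change Disjoint A B
      rw [disjoint_left]
      intro k hkA hkB
      obtain ⟨i, -, rfl⟩ := mem_image.1 (hQP hA)
      obtain ⟨j, -, rfl⟩ := mem_image.1 (hQP hB)
      exact hAB ((hsJ.part_eq hkA).symm.trans (hsJ.part_eq hkB))
  have hW : 5 * #U ≤ #(univ.filter fun v => π v ∈ U) := by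
    rw [card_eq_sum_card_fiberwise (f := π) (t := U) (fun v hv => by simpa using hv),
      mul_comm, ← smul_eq_mul, ← sum_const]
    refine sum_le_sum fun k hk => (hfib k).trans (card_le_card fun v => ?_)
    simp only [mem_filter, mem_univ, true_and]
    rintro rfl
    exact ⟨hk, rfl⟩
  set Xa := X.filter fun e => π (a e) ∈ U
  set Xb := X.filter fun e => π (b e) ∈ U
  have hWX : #(univ.filter fun v => π v ∈ U) ≤ #Xa + #Xb := by
    have h1 : univ.filter (fun v => π v ∈ U) ⊆ Xa.image a ∪ Xb.image b := by
      intro v hv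
      simp only [mem_filter, mem_univ, true_and] at hv
      obtain ⟨A, hA, hvA⟩ := mem_biUnion.1 hv
      have h2 := (mem_filter.1 hA).2 v hvA
      rcases mem_union.1 h2 with h3 | h3
      · obtain ⟨e, he, rfl⟩ := mem_image.1 h3
        exact mem_union_left _ (mem_image_of_mem _ (mem_filter.2 ⟨he, hv⟩))
      · obtain ⟨e, he, rfl⟩ := mem_image.1 h3
        exact mem_union_right _ (mem_image_of_mem _ (mem_filter.2 ⟨he, hv⟩))
    have h2 := (card_le_card h1).trans (card_union_le _ _)
    have h3 := card_image_le (s := Xa) (f := a)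
    have h4 := card_image_le (s := Xb) (f := b)
    omega
  have hXab : #(Xa ∪ Xb) + #(Xa ∩ Xb) = #Xa + #Xb := card_union_add_card_inter _ _
  have hXu : #(Xa ∪ Xb) ≤ #X :=
    card_le_card (union_subset (filter_subset _ _) (filter_subset _ _))
  have hXi : Xa ∩ Xb =
      (inner (π ∘ a) (π ∘ b) H U).filter fun e => (π ∘ b) e ∉ c ((π ∘ a) e) := by
    ext e
    simp only [Xa, Xb, hX, mem_inter, mem_filter, mem_inner, Function.comp]
    tauto
  have hQc := card_inner_biUnion hs hJH hQP
  change #(inner (π ∘ a) (π ∘ b) H U) + _ = _ at hQc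
  rw [← hc, ← hU, ← hXi] at hQc
  -- If `U` is nonempty, sparsity on `U` gives |Xa ∩ Xb| ≤ 2|Q| - 2, so 5|U| ≤ |X| + 2|Q| - 2 and,
  -- by |Q| ≤ |U|, 3|Q| ≤ |X| - 2. Together with 16|P| ≤ 2|X| + 16 + 16|Q| this contradicts |X| ≤
  -- 2|P| - 3. If `U` is empty, then |Q| = 0 suffices.
  rcases U.eq_empty_or_nonempty with h0 | h0
  · rw [h0, card_empty] at hQU
    omega
  · have := hs U h0
    omega

end SparseMatching

end

/-! ### Cuts of the contracted graph -/

namespace SparseMatching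

open Finset Classical

/-- A cut of the contracted graph contains an edge of the matching that misses a given vertex. -/
lemma exists_cut_edge {V K E : Type*} [Fintype K] {π : V → K} {a b : E → V} {H : Finset E}
    (hm : IsMatching a b H) (hs : Sparse (π ∘ a) (π ∘ b) H) (hc : #H + 2 = 2 * Fintype.card K)
    {A : Finset K} (hA : A.Nonempty) (hA' : Aᶜ.Nonempty) (v : V) :
    ∃ e ∈ H, ¬ Touches a b e v ∧ (π (a e) ∈ A ↔ π (b e) ∉ A) := by
  set X := H.filter fun e => (π (a e) ∈ A ↔ π (b e) ∉ A) with hX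
  have h1 := hs A hA
  have h2 := hs Aᶜ hA'
  have h3 : H ⊆ (inner (π ∘ a) (π ∘ b) H A ∪ inner (π ∘ a) (π ∘ b) H Aᶜ) ∪ X := by
    intro e he
    simp only [hX, mem_union, mem_inner, mem_filter, mem_compl, Function.comp]
    tauto
  have h4 := (card_le_card h3).trans (card_union_le _ _)
  have h5 := card_union_le (inner (π ∘ a) (π ∘ b) H A) (inner (π ∘ a) (π ∘ b) H Aᶜ)
  have h6 := card_add_card_compl A
  -- At least (2|K| - 2) - (2|A| - 2) - (2|Aᶜ| - 2) = 2 edges cross, and at most one edge of a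
  -- matching meets `v`.
  obtain ⟨e, he, f, hf, hef⟩ := one_lt_card.1 (show 1 < #X by omega)
  rw [hX, mem_filter] at he hf
  by_cases hev : Touches a b e v
  · exact ⟨f, hf.1, fun hfv => hef (hm e he.1 f hf.1 v hev hfv), hf.2⟩
  · exact ⟨e, he.1, hev, he.2⟩

end SparseMatching

namespace Graph

variable {α β : Type*} {F G : Graph α β}

/-! ### Connectedness through chains of adjacent vertices -/

section Connected

lemma reachable_of_reflTransGen {x y : α} (h : Relation.ReflTransGen G.Adj x y)
    (hx : x ∈ G.vertexSet) (hy : y ∈ G.vertexSet) :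
    G.toSimpleGraph.Reachable ⟨x, hx⟩ ⟨y, hy⟩ := by
  induction h with
  | refl => exact SimpleGraph.Reachable.refl _
  | @tail z w _ hzw ih =>
    refine (ih hzw.left_mem).trans ?_
    by_cases hne : z = w
    · subst hne; exact SimpleGraph.Reachable.refl _
    · exact SimpleGraph.Adj.reachable ⟨fun h => hne (congrArg Subtype.val h), hzw⟩

lemma isConnected_of_reflTransGen (hne : G.vertexSet.Nonempty)
    (h : ∀ x ∈ G.vertexSet, ∀ y ∈ G.vertexSet, Relation.ReflTransGen G.Adj x y) :
    G.IsConnected :=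
  haveI := hne.to_subtype
  SimpleGraph.Connected.mk fun x y => reachable_of_reflTransGen (h x x.2 y y.2) x.2 y.2

lemma reflTransGen_of_reachable {x y : G.vertexSet} (h : G.toSimpleGraph.Reachable x y) :
    Relation.ReflTransGen G.Adj x y := by
  obtain ⟨p⟩ := h
  induction p with
  | nil => exact .refl
  | cons hadj _ ih => exact .head hadj.2 ih

lemma deleteVerts_adj {X : Set α} {x y : α} :
    (G.deleteVerts X).Adj x y ↔ G.Adj x y ∧ x ∉ X ∧ y ∉ X := by
  simp [Adj]

lemma deleteVerts_mono (h : F ≤ G) (X : Set α) {x y : α} (hxy : (F.deleteVerts X).Adj x y) :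
    (G.deleteVerts X).Adj x y := by
  rw [deleteVerts_adj] at *
  exact ⟨hxy.1.mono h, hxy.2⟩

end Connected

/-! ### Components of a 2-factor are cycles -/

section TwoFactor

lemma le_of_hasCycleOfLength {k n : ℕ} (hg : (k : ℕ∞) ≤ F.girth) (h : F.HasCycleOfLength n) :
    k ≤ n := by
  have : F.girth ≤ n := iInf₂_le n h
  exact_mod_cast hg.trans this

lemma ne_of_isLink_of_girth {k : ℕ} (hk : 2 ≤ k) (hg : (k : ℕ∞) ≤ F.girth) {e : β} {x y : α}
    (h : F.IsLink e x y) : x ≠ y := by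
  rintro rfl
  have : F.HasCycleOfLength 1 := ⟨one_pos, fun _ => x, fun _ => e,
    fun _ _ _ => Subsingleton.elim (α := Fin 1) _ _,
    fun _ _ _ => Subsingleton.elim (α := Fin 1) _ _, fun _ => h⟩
  have := le_of_hasCycleOfLength hg this
  omega

lemma eq_of_isLink_of_girth {k : ℕ} (hk : 3 ≤ k) (hg : (k : ℕ∞) ≤ F.girth) {e f : β} {x y : α}
    (he : F.IsLink e x y) (hf : F.IsLink f x y) : e = f := by
  by_contra hef
  have hxy := ne_of_isLink_of_girth (by omega) hg he
  have : F.HasCycleOfLength 2 := by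
    refine ⟨two_pos, (![x, y] : Fin 2 → α), (![e, f] : Fin 2 → β), ?_, ?_, ?_⟩
    · intro i j hij
      change Fin 2 at i j
      fin_cases i <;> fin_cases j <;> first | rfl | (exfalso; simp_all)
    · intro i j hij
      change Fin 2 at i j
      fin_cases i <;> fin_cases j <;> first | rfl | (exfalso; simp_all)
    · intro i
      change Fin 2 at i
      fin_cases i
      · exact he
      · exact hf.symm
  have := le_of_hasCycleOfLength hg this
  omega

/-- Girth at least three excludes loops and parallel edges, so sending an edge at `v` to its other
end is a bijection. -/
lemma ncard_neighborSet {k : ℕ} (hk : 3 ≤ k) (hg : (k : ℕ∞) ≤ F.girth) (v : F.vertexSet) :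
    (F.toSimpleGraph.neighborSet v).ncard = F.degree v := by
  symm
  refine Set.ncard_congr (fun e (he : F.Inc e v) => ⟨he.other, he.isLink_other.right_mem⟩)
    ?_ ?_ ?_
  · intro e he
    have h := Inc.isLink_other he
    exact ⟨fun h' => ne_of_isLink_of_girth (by omega) hg h (congrArg Subtype.val h'), e, h⟩
  · intro e f he hf hef
    have h1 := Inc.isLink_other he
    have h2 := Inc.isLink_other hf
    have h3 : Inc.other he = Inc.other hf := congrArg Subtype.val hef
    exact eq_of_isLink_of_girth hk hg h1 (h3 ▸ h2)
  · rintro w ⟨-, e, he⟩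
    refine ⟨e, he.inc_left, Subtype.ext ?_⟩
    exact (Inc.isLink_other he.inc_left).right_unique he

lemma hasCycleOfLength_of_isCycle {v : F.vertexSet} {p : F.toSimpleGraph.Walk v v}
    (hp : p.IsCycle) : F.HasCycleOfLength p.length := by
  have h3 := hp.three_le_length
  have : NeZero p.length := ⟨by omega⟩
  have : Fact (1 < p.length) := ⟨by omega⟩
  have hinj : Function.Injective fun i : ZMod p.length => p.getVert i.val := by
    intro i j hij
    have h1 := ZMod.val_lt i
    have h2 := ZMod.val_lt j
    exact ZMod.val_injective _ (hp.getVert_injOn' (by simp; omega) (by simp; omega) hij)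
  have hadj : ∀ i : ZMod p.length, F.Adj (p.getVert i.val) (p.getVert (i + 1).val) := by
    intro i
    have h1 := ZMod.val_lt i
    have h2 := p.adj_getVert_succ h1
    have h4 : p.getVert (i + 1).val = p.getVert (i.val + 1) := by
      rw [ZMod.val_add, ZMod.val_one]
      rcases Nat.lt_or_ge (i.val + 1) p.length with h | h
      · rw [Nat.mod_eq_of_lt h]
      · have : i.val + 1 = p.length := by omega
        rw [this, Nat.mod_self, p.getVert_zero, p.getVert_length]
    rw [h4]
    exact h2.2
  choose e he using hadj
  refine ⟨by omega, fun i => p.getVert i.val, e, Subtype.val_injective.comp hinj, ?_, he⟩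
  intro i j hij
  have h1 := he i
  rw [hij] at h1
  -- Equal edges with swapped ends would force 2 = 0 modulo the length, which is at least three.
  rcases h1.eq_and_eq_or_eq_and_eq (he j) with h | h
  · exact hinj (Subtype.ext h.1)
  · have h5 : i = j + 1 := hinj (Subtype.ext h.1)
    have h6 : i + 1 = j := hinj (Subtype.ext h.2)
    have h7 : ((2 : ℕ) : ZMod p.length) = 0 := by
      have : j + 1 + 1 = j := by rw [← h5, h6]
      push_cast
      linear_combination this
    rw [ZMod.natCast_eq_zero_iff] at h7
    have := Nat.le_of_dvd two_pos h7
    omega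

variable {k : ℕ}

lemma exists_isCycle (hV : F.vertexSet.Finite) (hdeg : ∀ v ∈ F.vertexSet, F.degree v = 2)
    (hk : 3 ≤ k) (hg : (k : ℕ∞) ≤ F.girth) (v : F.vertexSet) :
    ∃ p : F.toSimpleGraph.Walk v v, p.IsCycle ∧
      p.toSubgraph.verts = (F.toSimpleGraph.connectedComponentMk v).supp := by
  have := hV.to_subtype
  have h2 : ∀ w, (F.toSimpleGraph.neighborSet w).ncard = 2 := fun w => by
    rw [ncard_neighborSet hk hg, hdeg w w.2]
  have hc : F.toSimpleGraph.IsCycles := fun w _ => h2 w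
  refine hc.exists_cycle_toSubgraph_verts_eq_connectedComponentSupp (v := v) rfl ?_
  apply Set.nonempty_of_ncard_ne_zero
  rw [h2]
  omega

/-- A component of a graph with all degrees two has at least as many vertices as the girth. -/
lemma le_ncard_supp (hV : F.vertexSet.Finite) (hdeg : ∀ v ∈ F.vertexSet, F.degree v = 2)
    (hk : 3 ≤ k) (hg : (k : ℕ∞) ≤ F.girth) (c : F.toSimpleGraph.ConnectedComponent) :
    k ≤ c.supp.ncard := by
  have := hV.to_subtype
  obtain ⟨v, rfl⟩ := c.exists_rep
  obtain ⟨p, hp, hverts⟩ := exists_isCycle hV hdeg hk hg v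
  change k ≤ (F.toSimpleGraph.connectedComponentMk v).supp.ncard
  rw [← hverts]
  refine (le_of_hasCycleOfLength hg (hasCycleOfLength_of_isCycle hp)).trans ?_
  have h3 := hp.three_le_length
  have h1 : (p.getVert '' {i | i ≤ p.length - 1}).ncard = p.length := by
    rw [hp.getVert_injOn'.ncard_image]
    have : {i | i ≤ p.length - 1} = (Finset.range p.length : Set ℕ) := by
      ext i
      simp
      omega
    rw [this, Set.ncard_coe_finset, Finset.card_range]
  rw [← h1]
  refine Set.ncard_le_ncard ?_ (Set.toFinite _)
  rintro _ ⟨i, -, rfl⟩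
  rw [SimpleGraph.Walk.mem_verts_toSubgraph]
  exact p.getVert_mem_support i

/-- Deleting a vertex does not disconnect the components of a graph with all degrees two. -/
lemma reflTransGen_deleteVerts (hV : F.vertexSet.Finite)
    (hdeg : ∀ v ∈ F.vertexSet, F.degree v = 2) (hk : 3 ≤ k) (hg : (k : ℕ∞) ≤ F.girth)
    (v : F.vertexSet) {x y : F.vertexSet} (hx : x ≠ v) (hy : y ≠ v)
    (hxy : F.toSimpleGraph.Reachable x y) :
    Relation.ReflTransGen (F.deleteVerts {(v : α)}).Adj x y := by
  have adj : ∀ z w : F.vertexSet, z ≠ v → w ≠ v → F.Adj z w →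
      (F.deleteVerts {(v : α)}).Adj z w := fun z w hz hw h =>
    deleteVerts_adj.2 ⟨h, fun h' => hz (Subtype.ext h'), fun h' => hw (Subtype.ext h')⟩
  by_cases hvx : F.toSimpleGraph.Reachable v x
  -- Start the cycle at `v`: the other vertices of the component occupy positions 1 to length - 1,
  -- which form a path missing `v`.
  · obtain ⟨p, hp, hverts⟩ := exists_isCycle hV hdeg hk hg v
    have hpos : ∀ z : F.vertexSet, z ≠ v → F.toSimpleGraph.Reachable v z →
        ∃ i, 1 ≤ i ∧ i < p.length ∧ p.getVert i = z := by
      intro z hz hvz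
      have : z ∈ p.toSubgraph.verts := by
        rw [hverts]
        exact SimpleGraph.ConnectedComponent.sound hvz.symm
      rw [SimpleGraph.Walk.mem_verts_toSubgraph,
        SimpleGraph.Walk.mem_support_iff_exists_getVert] at this
      obtain ⟨i, rfl, hi⟩ := this
      refine ⟨i, ?_, lt_of_le_of_ne hi ?_, rfl⟩
      · rw [Nat.one_le_iff_ne_zero]
        rintro rfl
        exact hz p.getVert_zero
      · rintro rfl
        exact hz p.getVert_length
    have hne : ∀ i, 1 ≤ i → i < p.length → p.getVert i ≠ v := by
      intro i h1 h2 h3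
      have := hp.getVert_injOn' (show i ∈ {i | i ≤ p.length - 1} by simp; omega)
        (show 0 ∈ {i | i ≤ p.length - 1} by simp) (by rw [h3, p.getVert_zero])
      omega
    have hchain : ∀ i j, 1 ≤ i → i ≤ j → j < p.length →
        Relation.ReflTransGen (F.deleteVerts {(v : α)}).Adj (p.getVert i) (p.getVert j) := by
      intro i j hi hij
      induction j, hij using Nat.le_induction with
      | base => exact fun _ => .refl
      | succ m hm ih =>
        intro hlt
        refine (ih (by omega)).tail (adj _ _ (hne m (by omega) (by omega))
          (hne (m + 1) (by omega) hlt) ?_)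
        exact (p.adj_getVert_succ (by omega)).2
    obtain ⟨i, hi1, hi, rfl⟩ := hpos x hx hvx
    obtain ⟨j, hj1, hj, rfl⟩ := hpos y hy (hvx.trans hxy)
    rcases le_total i j with h | h
    · exact hchain i j hi1 h hj
    · exact symm (r := Relation.ReflTransGen (F.deleteVerts {(v : α)}).Adj) (hchain j i hj1 h hi)
  -- Here `v` lies in another component, so no walk from `x` meets it.
  · have key : ∀ z w : F.vertexSet, F.toSimpleGraph.Walk z w → ¬ F.toSimpleGraph.Reachable v z →
        Relation.ReflTransGen (F.deleteVerts {(v : α)}).Adj z w := by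
      intro z w p
      induction p with
      | nil => exact fun _ => .refl
      | @cons a b c hab _ ih =>
        intro hva
        have hvb : ¬ F.toSimpleGraph.Reachable v b := fun h => hva (h.trans hab.symm.reachable)
        refine .head (adj _ _ ?_ ?_ hab.2) (ih hvb)
        · rintro rfl; exact hva (SimpleGraph.Reachable.refl _)
        · rintro rfl; exact hvb (SimpleGraph.Reachable.refl _)
    obtain ⟨p⟩ := hxy
    exact key x y p hvx

end TwoFactor

/-! ### Adding the matching to the 2-factor -/

open SparseMatching in
/-- The main theorem, with the weaker of the toughness conditions and for multigraphs. -/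
theorem exists_isTwoConnected_factor (hV : G.vertexSet.Finite) (hE : G.edgeSet.Finite)
    (hne : G.vertexSet.Nonempty) (hF : F.IsFactor {2} G) (hg : 5 ≤ F.girth)
    (htough : ∀ S ⊆ G.vertexSet,
      ((G.deleteVerts S).numComponents : ℝ) ≤ (S.ncard : ℝ) / 16 + 1) :
    ∃ H : Graph α β, Graph.IsFactor {2, 3} H G ∧ F ≤ H ∧ H.IsTwoConnected := by
  classical
  obtain ⟨hFG, hdeg⟩ := hF
  have hVF : F.vertexSet = G.vertexSet := hFG.vertexSet_eq
  have hVfin : F.vertexSet.Finite := hVF ▸ hV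
  have hg' : ((5 : ℕ) : ℕ∞) ≤ F.girth := hg
  have hdeg' : ∀ v ∈ F.vertexSet, F.degree v = 2 := hdeg
  have := hVfin.to_subtype
  have := hE.to_subtype
  have : Nonempty F.vertexSet := (hVF ▸ hne).to_subtype
  let _ := Fintype.ofFinite F.vertexSet
  let _ := Fintype.ofFinite G.edgeSet
  let _ := Fintype.ofFinite F.toSimpleGraph.ConnectedComponent
  have hends : ∀ e : G.edgeSet, ∃ x y : F.vertexSet, G.IsLink e x y := by
    rintro ⟨e, he⟩
    obtain ⟨x, y, h⟩ := exists_isLink_of_mem_edgeSet he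
    exact ⟨⟨x, hVF ▸ h.left_mem⟩, ⟨y, hVF ▸ h.right_mem⟩, h⟩
  choose a b hab using hends
  let π : F.vertexSet → F.toSimpleGraph.ConnectedComponent :=
    F.toSimpleGraph.connectedComponentMk
  have hfib : ∀ k, 5 ≤ (Finset.univ.filter fun v => π v = k).card := by
    intro k
    have h := le_ncard_supp hVfin hdeg' (by norm_num) hg' k
    rw [← Set.ncard_coe_finset]
    convert h using 2
    ext v
    simp [π]
  obtain ⟨M, hm, hs, hcard⟩ : ∃ M : Finset G.edgeSet, IsMatching a b M ∧
      Sparse (π ∘ a) (π ∘ b) M ∧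
        M.card + 2 = 2 * Fintype.card F.toSimpleGraph.ConnectedComponent := by
    refine exists_sparse_matching π a b hfib fun Z c hZ => ?_
    set S : Set α := Subtype.val '' (Z : Set F.vertexSet) with hS
    have hSV : S ⊆ G.vertexSet := by
      rintro _ ⟨v, -, rfl⟩
      exact hVF ▸ v.2
    have hScard : S.ncard = Z.card := by
      rw [hS, Set.ncard_image_of_injective _ Subtype.val_injective, Set.ncard_coe_finset]
    have hmemS : ∀ v : F.vertexSet, (v : α) ∈ S ↔ v ∈ Z := by
      intro v
      simp [hS]
    have hadj : ∀ x y, (G.deleteVerts S).Adj x y → ∀ (hx : x ∈ F.vertexSet)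
        (hy : y ∈ F.vertexSet), c (π ⟨x, hx⟩) = c (π ⟨y, hy⟩) := by
      intro x y hxy hx hy
      obtain ⟨⟨e, he⟩, hxS, hyS⟩ := deleteVerts_adj.1 hxy
      have hx' := (hmemS ⟨x, hx⟩).not.1 hxS
      have hy' := (hmemS ⟨y, hy⟩).not.1 hyS
      rcases he.eq_and_eq_or_eq_and_eq (hab ⟨e, he.edge_mem⟩) with ⟨h1, h2⟩ | ⟨h1, h2⟩
      · have h1 : (⟨x, hx⟩ : F.vertexSet) = a ⟨e, he.edge_mem⟩ := Subtype.ext h1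
        have h2 : (⟨y, hy⟩ : F.vertexSet) = b ⟨e, he.edge_mem⟩ := Subtype.ext h2
        rw [h1] at hx' ⊢
        rw [h2] at hy' ⊢
        exact hZ _ ⟨hx', hy'⟩
      · have h1 : (⟨x, hx⟩ : F.vertexSet) = b ⟨e, he.edge_mem⟩ := Subtype.ext h1
        have h2 : (⟨y, hy⟩ : F.vertexSet) = a ⟨e, he.edge_mem⟩ := Subtype.ext h2
        rw [h1] at hx' ⊢
        rw [h2] at hy' ⊢
        exact (hZ _ ⟨hy', hx'⟩).symm
    have hpath : ∀ x y, Relation.ReflTransGen (G.deleteVerts S).Adj x y →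
        ∀ (hx : x ∈ F.vertexSet) (hy : y ∈ F.vertexSet), c (π ⟨x, hx⟩) = c (π ⟨y, hy⟩) := by
      intro x y h hx
      induction h with
      | refl => exact fun _ => rfl
      | @tail z w _ hzw ih =>
        intro hw
        have hz : z ∈ F.vertexSet := hVF ▸ (deleteVerts_adj.1 hzw).1.left_mem
        exact (ih hz).trans (hadj z w hzw hz hw)
    -- A representative vertex for each value of `c` gives distinct components, as `c` is constant
    -- along paths avoiding `S`.
    have hle : (Zᶜ.image fun v => c (π v)).card ≤ (G.deleteVerts S).numComponents := by
      rw [← Nat.card_eq_finsetCard, numComponents]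
      have hex : ∀ t : (Zᶜ.image fun v => c (π v) : Finset _),
          ∃ v : F.vertexSet, v ∉ Z ∧ c (π v) = t := by
        rintro ⟨t, ht⟩
        simpa using ht
      choose r hrZ hrc using hex
      have hrV : ∀ t, (r t : α) ∈ (G.deleteVerts S).vertexSet := fun t => by
        rw [vertexSet_deleteVerts]
        exact ⟨hVF ▸ (r t).2, (hmemS _).not.2 (hrZ t)⟩
      have : Finite (G.deleteVerts S).vertexSet := by
        rw [vertexSet_deleteVerts]
        exact (hV.sdiff).to_subtype
      refine Nat.card_le_card_of_injective
        (fun t => (G.deleteVerts S).toSimpleGraph.connectedComponentMk ⟨r t, hrV t⟩) ?_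
      intro t t' htt
      have h1 := reflTransGen_of_reachable (SimpleGraph.ConnectedComponent.exact htt)
      have h2 := hpath _ _ h1 (r t).2 (r t').2
      exact Subtype.ext ((hrc t).symm.trans (h2.trans (hrc t')))
    have h1 := htough S hSV
    rw [hScard] at h1
    have h2 : ((Zᶜ.image fun v => c (π v)).card : ℝ) ≤ (Z.card : ℝ) / 16 + 1 :=
      (Nat.cast_le.2 hle).trans h1
    have h3 : (16 * (Zᶜ.image fun v => c (π v)).card : ℝ) ≤ Z.card + 16 := by linarith
    have h4 : 16 * (Zᶜ.image fun v => c (π v)).card ≤ Z.card + 16 := by exact_mod_cast h3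
    convert h4
  set H := G.restrict (F.edgeSet ∪ Subtype.val '' (M : Set G.edgeSet)) with hH
  have hHV : H.vertexSet = G.vertexSet := rfl
  have hFH : F ≤ H := ⟨hVF.le, fun e x y h => ⟨.inl h.edge_mem, h.mono hFG.le⟩⟩
  have hHfac : Graph.IsFactor {2, 3} H G := by
    refine ⟨⟨restrict_le, rfl⟩, fun v hv => ?_⟩
    have hvF : v ∈ F.vertexSet := hVF ▸ hv
    have h1 : H.incidenceSet v ⊆ F.incidenceSet v ∪
        Subtype.val '' {e : G.edgeSet | e ∈ M ∧ Touches a b e ⟨v, hvF⟩} := by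
      intro e he
      obtain ⟨hinc, he' | ⟨e, heM, rfl⟩⟩ := restrict_inc.1 he
      · exact .inl ((hFG.le.inc_congr he').2 hinc)
      · refine .inr ⟨e, ⟨heM, ?_⟩, rfl⟩
        rcases hinc.eq_or_eq_of_isLink (hab e) with h | h
        · exact .inl (Subtype.ext h.symm)
        · exact .inr (Subtype.ext h.symm)
    have h2 : F.incidenceSet v ⊆ H.incidenceSet v := fun e he => Inc.mono hFH he
    have h3 : (F.incidenceSet v).ncard = 2 := hdeg' v hvF
    have hHfin : (H.incidenceSet v).Finite :=
      hE.subset fun e he => (restrict_inc.1 he).1.edge_mem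
    have h4 : (Subtype.val '' {e : G.edgeSet | e ∈ M ∧ Touches a b e ⟨v, hvF⟩}).ncard ≤ 1 := by
      rw [Set.ncard_image_of_injective _ Subtype.val_injective,
        Set.ncard_le_one (Set.toFinite _)]
      rintro e ⟨he, hev⟩ f ⟨hf, hfv⟩
      exact hm e he f hf _ hev hfv
    have h5 := Set.ncard_le_ncard h2 hHfin
    have h6 := (Set.ncard_le_ncard h1 ((hHfin.subset h2).union
      ((Set.toFinite _).image _))).trans (Set.ncard_union_le _ _)
    change (H.incidenceSet v).ncard = 2 ∨ (H.incidenceSet v).ncard = 3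
    omega
  have hcard5 : 5 ≤ F.vertexSet.ncard := by
    have v : F.vertexSet := Classical.arbitrary _
    refine (le_ncard_supp hVfin hdeg' (by norm_num) hg' (π v)).trans ?_
    rw [← Nat.card_coe_set_eq F.vertexSet, ← Set.ncard_univ]
    exact Set.ncard_le_ncard (Set.subset_univ _) (Set.toFinite _)
  have hdel : ∀ v x y : F.vertexSet, x ≠ v → y ≠ v →
      Relation.ReflTransGen (H.deleteVerts {(v : α)}).Adj x y := by
    intro v x y hx hy
    have hsame : ∀ z w : F.vertexSet, z ≠ v → w ≠ v → π z = π w →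
        Relation.ReflTransGen (H.deleteVerts {(v : α)}).Adj z w := fun z w hz hw hzw =>
      Relation.ReflTransGen.mono (fun _ _ => deleteVerts_mono hFH _) _ _
        (reflTransGen_deleteVerts hVfin hdeg' (by norm_num) hg' v hz hw
          (SimpleGraph.ConnectedComponent.exact hzw))
    -- The cycles of `F` reached from `x` without passing through `v`. If some cycle were not
    -- reached, a matching edge missing `v` would cross the cut and extend the reach.
    set A := Finset.univ.filter fun k => ∃ z : F.vertexSet, z ≠ v ∧ π z = k ∧
      Relation.ReflTransGen (H.deleteVerts {(v : α)}).Adj x z with hA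
    have hmemA : ∀ z : F.vertexSet, z ≠ v → π z ∈ A →
        Relation.ReflTransGen (H.deleteVerts {(v : α)}).Adj x z := by
      intro z hz hzA
      simp only [hA, Finset.mem_filter, Finset.mem_univ, true_and] at hzA
      obtain ⟨w, hw, hwz, hxw⟩ := hzA
      exact hxw.trans (hsame w z hw hz hwz)
    have hAne : A.Nonempty := ⟨π x, by
      simp only [hA, Finset.mem_filter, Finset.mem_univ, true_and]
      exact ⟨x, hx, rfl, .refl⟩⟩
    by_cases hAc : (Aᶜ).Nonempty
    · exfalso
      obtain ⟨e, heM, hev, hcross⟩ := exists_cut_edge hm hs hcard hAne hAc v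
      have hav : a e ≠ v := fun h => hev (.inl h)
      have hbv : b e ≠ v := fun h => hev (.inr h)
      have hadj : (H.deleteVerts {(v : α)}).Adj (a e) (b e) :=
        deleteVerts_adj.2 ⟨⟨e, .inr ⟨e, heM, rfl⟩, hab e⟩,
          fun h => hav (Subtype.ext h), fun h => hbv (Subtype.ext h)⟩
      have hstep : ∀ z w : F.vertexSet, z ≠ v → w ≠ v →
          (H.deleteVerts {(v : α)}).Adj z w → π z ∈ A → π w ∈ A := by
        intro z w hz hw hzw hzA
        have := (hmemA z hz hzA).tail hzw
        simp only [hA, Finset.mem_filter, Finset.mem_univ, true_and]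
        exact ⟨w, hw, rfl, this⟩
      have h1 := hstep _ _ hav hbv hadj
      have h2 := hstep _ _ hbv hav hadj.symm
      tauto
    · rw [Finset.not_nonempty_iff_eq_empty, Finset.compl_eq_empty_iff] at hAc
      exact hmemA y hy (hAc ▸ Finset.mem_univ _)
  have hother : ∀ x y : F.vertexSet, ∃ v : F.vertexSet, x ≠ v ∧ y ≠ v := by
    intro x y
    by_contra! hall
    have : (Set.univ : Set F.vertexSet) ⊆ {x, y} := fun v _ => by
      by_cases h : x = v
      · exact .inl h.symm
      · exact .inr (hall v h).symm
    have h1 := (Set.ncard_le_ncard this (Set.toFinite _)).trans (Set.ncard_insert_le _ _)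
    rw [Set.ncard_univ, Nat.card_coe_set_eq, Set.ncard_singleton] at h1
    omega
  refine ⟨H, hHfac, hFH, ?_, ?_, ?_⟩
  · rw [hHV, ← hVF, ← hVfin.cast_ncard_eq]
    exact_mod_cast (by omega : 3 ≤ F.vertexSet.ncard)
  -- Connectedness of `H` itself comes from deleting a third vertex.
  · refine isConnected_of_reflTransGen hne fun x hx y hy => ?_
    obtain ⟨v, hxv, hyv⟩ := hother ⟨x, hVF ▸ hx⟩ ⟨y, hVF ▸ hy⟩
    exact Relation.ReflTransGen.mono (fun _ _ h => (deleteVerts_adj.1 h).1) _ _ (hdel v _ _ hxv hyv)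
  · intro v hv
    refine isConnected_of_reflTransGen ?_ fun x hx y hy => ?_
    · obtain ⟨w, hw, -⟩ := hother ⟨v, hVF ▸ hv⟩ ⟨v, hVF ▸ hv⟩
      refine ⟨w, ?_⟩
      rw [vertexSet_deleteVerts]
      exact ⟨hVF ▸ w.2, fun h => hw (Subtype.ext (Set.mem_singleton_iff.1 h).symm)⟩
    · rw [vertexSet_deleteVerts] at hx hy
      exact hdel ⟨v, hVF ▸ hv⟩ ⟨x, hVF ▸ hx.1⟩ ⟨y, hVF ▸ hy.1⟩
        (fun h => hx.2 (congrArg Subtype.val h)) (fun h => hy.2 (congrArg Subtype.val h))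

end Graph

theorem corollary16 {α β : Type*} (G : Graph α β)
    (hV : G.vertexSet.Finite) (hE : G.edgeSet.Finite) :
    (G.Simple → G.vertexSet.Nonempty →
      ∀ F : Graph α β, Graph.IsFactor {2} F G → 5 ≤ F.girth →
        (∀ S ⊆ G.vertexSet,
          ((G.deleteVerts S).numComponents : ℝ) ≤ (S.ncard : ℝ) / 16 + 1) →
        ∃ H : Graph α β, Graph.IsFactor {2, 3} H G ∧ F ≤ H ∧ H.IsTwoConnected) ∧
    (G.Loopless → 3 ≤ G.vertexSet.ncard → G.IsTough 16 →
      (∃ F : Graph α β, Graph.IsFactor {2} F G ∧ 5 ≤ F.girth) →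
        ∃ H : Graph α β, Graph.IsFactor {2, 3} H G ∧ H.IsTwoConnected) := by
  refine ⟨fun _ hne F hF hg ht => Graph.exists_isTwoConnected_factor hV hE hne hF hg ht, ?_⟩
  rintro _ h3 ht ⟨F, hF, hg⟩
  have hne : G.vertexSet.Nonempty := Set.nonempty_of_ncard_ne_zero (by omega)
  -- Toughness 16 gives the weaker bound because max {1, |S|/16} ≤ |S|/16 + 1.
  obtain ⟨H, hH, -, hH2⟩ := Graph.exists_isTwoConnected_factor hV hE hne hF hg fun S hS =>
    (ht S hS).trans (max_le (by linarith [show (0 : ℝ) ≤ (S.ncard : ℝ) / 16 by positivity])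
      (by linarith))
  exact ⟨H, hH, hH2⟩
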